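/- Let $\mathbb F$ be a field with algebraic closure $\overline{\mathbb F}$. A matrix pencil is a matrix over $\mathbb F[s]$ whose entries have degree at most one; a square pencil $G(s)$ is regular if $\det G(s)$ is not the zero polynomial, and $\operatorname{rank} G(s)$ is the rank of $G(s)$ over $\mathbb F(s)$. For an $n\times n$ polynomial matrix $G(s)$, let $D_0=1$ and let $D_k(s)$ be the monic greatest common divisor of the minors of order $k$ of $G(s)$. If $G(s)=G_0+sG_1$ is a regular pencil, its invariant factors are $\gamma_k=D_k/D_{k-1}$, $1\le k\le n$; they are monic and $\gamma_1\mid\dots\mid\gamma_n$. For $\lambda\in\overline{\mathbb F}$, the partial multiplicity $m_i(\lambda,G)$ is the multiplicity of $\lambda$ as a root of $\gamma_i$. The partial multiplicity at infinity, $m_i(\infty,G)$, is the integer $q_i\ge 0$ such that the $i$-th invariant factor of $tG_0+G_1\in\mathbb F[t]^{n\times n}$ is $k_i\,t^{q_i}\,t^{\deg\gamma_i}\gamma_i(1/t)$ for some $0\ne k_i\in\mathbb F$. For every $\lambda\in\overline{\mathbb F}\cup\{\infty\}$ one has $m_1(\lambda,G)\le\dots\le m_n(\lambda,G)$. Put $$\mu_a(\lambda,G)=\sum_{i=1}^n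 m_i(\lambda,G),\qquad M_r(\lambda,G)=\sum_{i=n-r+1}^n m_i(\lambda,G)\quad(0\le r\le n),$$ so that $M_r(\lambda,G)$ is the sum of the $r$ largest partial multiplicities of $G$ at $\lambda$. **Corollary.** Let $A(s),P(s)\in\mathbb F[s]^{n\times n}$ be matrix pencils with $\operatorname{rank}P(s)=r$. Assume that $A(s)$ and $A(s)+P(s)$ are regular. Then $$\mu_a(\lambda,A)-M_r(\lambda,A)\le\mu_a(\lambda,A+P)\qquad\text{for every }\lambda\in\overline{\mathbb F}\cup\{\infty\}.$$ -/

import Mathlib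

open Polynomial

open scoped OnePoint

namespace MatrixPencil

noncomputable section

variable {F : Type*} [Field F] {m n : ℕ}

/-- A polynomial matrix is a matrix pencil if all its entries have degree at most one. -/
def IsPencil (G : Matrix (Fin m) (Fin n) F[X]) : Prop :=
  ∀ i j, (G i j).degree ≤ 1

/-- A pencil is regular if it is square and its determinant is not the zero polynomial. -/
def IsRegular (G : Matrix (Fin n) (Fin n) F[X]) : Prop :=
  IsPencil G ∧ G.det ≠ 0

/-- The normal rank of a polynomial matrix: its rank over the field of fractions of `F[X]`. -/
def normalRank (G : Matrix (Fin m) (Fin n) F[X]) : ℕ :=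
  (G.map (algebraMap F[X] (RatFunc F))).rank

open scoped Classical in
/-- The determinantal divisor `D k` of order `k`: the monic greatest common divisor of the minors
of order `k` (each given by `k` increasing row indices and `k` increasing column indices).
Thus `D 0 = 1`, and `D k = 0` when `k` exceeds the rank. -/
def determinantalDivisor (G : Matrix (Fin m) (Fin n) F[X]) (k : ℕ) : F[X] :=
  letI : NormalizedGCDMonoid F[X] := UniqueFactorizationMonoid.toNormalizedGCDMonoid F[X]
  (Finset.univ : Finset ((Fin k ↪o Fin m) × (Fin k ↪o Fin n))).gcd
    fun p => (G.submatrix p.1 p.2).det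

/-- `D k` is a greatest common divisor of the minors of order `k`. -/
theorem dvd_determinantalDivisor_iff (G : Matrix (Fin m) (Fin n) F[X]) (k : ℕ) (d : F[X]) :
    d ∣ determinantalDivisor G k ↔
      ∀ (f : Fin k ↪o Fin m) (g : Fin k ↪o Fin n), d ∣ (G.submatrix f g).det := by
  classical
  unfold determinantalDivisor
  simp [Finset.dvd_gcd_iff]

/-- `D k` is monic unless all minors of order `k` vanish. -/
theorem determinantalDivisor_monic (G : Matrix (Fin m) (Fin n) F[X]) (k : ℕ)
    (h : determinantalDivisor G k ≠ 0) : (determinantalDivisor G k).Monic := by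
  classical
  have h1 : normalize (determinantalDivisor G k) = determinantalDivisor G k := by
    unfold determinantalDivisor
    exact @Finset.normalize_gcd _ _ _ (UniqueFactorizationMonoid.toNormalizedGCDMonoid F[X]) _ _
  rw [← h1]
  exact Polynomial.monic_normalize h

/-- The `k`-th invariant factor `γ k = D k / D (k - 1)`, for `1 ≤ k` (the division is exact).
It is `0` when `k` exceeds the rank. -/
def invariantFactor (G : Matrix (Fin m) (Fin n) F[X]) (k : ℕ) : F[X] :=
  determinantalDivisor G k / determinantalDivisor G (k - 1)

/-- For a pencil `G(s) = G₀ + s G₁`, the reversed pencil `t G₀ + G₁`. -/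
def reversal (G : Matrix (Fin m) (Fin n) F[X]) : Matrix (Fin m) (Fin n) F[X] :=
  G.map fun p => X * C (p.coeff 0) + C (p.coeff 1)

/-- The partial multiplicity at infinity `q i`: the exponent of `t` in the factorization
`γbar i = k i * t ^ (q i) * (t ^ deg (γ i) * γ i (1 / t))`, where `γ i` and `γbar i` are the
invariant factors of `G` and of its reversal. As `t` does not divide `t ^ deg (γ i) * γ i (1 / t)`,
this is the multiplicity of `0` as a root of `γbar i`; see `partialMultiplicityAtInfty_eq`. -/
def partialMultiplicityAtInfty (G : Matrix (Fin m) (Fin n) F[X]) (i : ℕ) : ℕ :=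
  (invariantFactor (reversal G) i).rootMultiplicity 0

/-- In Mathlib, `γ.reverse` is `t ^ deg γ * γ (1 / t)`. -/
theorem partialMultiplicityAtInfty_eq (G : Matrix (Fin m) (Fin n) F[X]) (i q : ℕ) (k : F)
    (hk : k ≠ 0) (hi : invariantFactor G i ≠ 0)
    (h : invariantFactor (reversal G) i = C k * (X ^ q * (invariantFactor G i).reverse)) :
    partialMultiplicityAtInfty G i = q := by
  have h0 : (invariantFactor G i).reverse ≠ 0 := by simpa using hi
  have h1 : (invariantFactor G i).reverse.rootMultiplicity 0 = 0 := by
    rw [Polynomial.rootMultiplicity_eq_zero_iff]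
    intro hr
    simp [Polynomial.IsRoot, ← Polynomial.coeff_zero_eq_eval_zero] at hr
    exact absurd hr hi
  have hXq : ((X : F[X]) ^ q).rootMultiplicity 0 = q := by
    simpa using Polynomial.rootMultiplicity_X_sub_C_pow (0 : F) q
  unfold partialMultiplicityAtInfty
  rw [h, Polynomial.rootMultiplicity_mul (by simp [hk, h0]),
    Polynomial.rootMultiplicity_mul (by simp [h0]), h1, hXq]
  simp

/-- The `i`-th partial multiplicity of `G` at `z`, a point of the algebraic closure of `F` or `∞`
(`1 ≤ i`). At a finite point it is the exponent of `s - z` in the factorization of the `i`-th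
invariant factor over the algebraic closure. -/
def partialMultiplicity (z : OnePoint (AlgebraicClosure F))
    (G : Matrix (Fin n) (Fin n) F[X]) (i : ℕ) : ℕ :=
  match z with
  | ∞ => partialMultiplicityAtInfty G i
  | (a : AlgebraicClosure F) =>
      ((invariantFactor G i).map (algebraMap F (AlgebraicClosure F))).rootMultiplicity a

/-- The algebraic multiplicity: the sum of the partial multiplicities of index `1, …, n`. -/
def algebraicMultiplicity (z : OnePoint (AlgebraicClosure F))
    (G : Matrix (Fin n) (Fin n) F[X]) : ℕ :=
  ∑ i ∈ Finset.Icc 1 n, partialMultiplicity z G i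

/-- `M_r(z, G)`: the sum of the partial multiplicities of index `n - r + 1, …, n`. As the partial
multiplicities increase with the index, these are the `r` largest ones (`r ≤ n`). -/
def largestMultiplicitySum (r : ℕ) (z : OnePoint (AlgebraicClosure F))
    (G : Matrix (Fin n) (Fin n) F[X]) : ℕ :=
  ∑ i ∈ Finset.Icc (n - r + 1) n, partialMultiplicity z G i

end

end MatrixPencil

/-! The invariant factors telescope: at a finite point, the `n - r` smallest partial multiplicities
of `A` add up to the multiplicity of the root in the determinantal divisor of order `n - r`, so it
is enough that this divisor divides `det (A + P)` (`dvd_det_add`). Expand `det (A + P)`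
multilinearly in the rows. A term with at least `n - r` rows from `A` is, by Laplace expansion, a
combination of minors of `A` of order `n - r`; any other term has more than `r` rows from `P` and
vanishes, since `P` has rank `r`. The point at infinity is the point `0` of the reversed pencils.
Reversal is additive and preserves both regularity and the vanishing of minors of pencils. -/

namespace MatrixPencil

/-! ### Divisibility of determinants by minors -/

section CommRing

variable {R : Type*} [CommRing R]

/-- If `d` divides all minors of order `k` that use only rows from a set of at least `k` rows,
then `d` divides the determinant. -/
theorem dvd_det_of_forall_dvd_minor {d : R} {k : ℕ} :
    ∀ {m : ℕ} (M : Matrix (Fin m) (Fin m) R) (S : Finset (Fin m)), k ≤ S.card →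
      (∀ f g : Fin k ↪o Fin m, (∀ i, f i ∈ S) → d ∣ (M.submatrix f g).det) → d ∣ M.det := by
  intro m
  induction m with
  | zero =>
    intro M S hS h
    have hk : k = 0 := by
      have := S.card_le_univ
      simp at this
      simp_all
    subst hk
    have := h (RelEmbedding.refl _) (RelEmbedding.refl _) (fun i => i.elim0)
    simpa using this
  | succ m ih =>
    intro M S hS h
    rcases Nat.lt_or_ge k (m + 1) with hk | hk
    -- Shrinking `S` to exactly `k < m + 1` rows leaves a row `i` outside `T`; expanding along it
    -- keeps all rows of `T` in every cofactor.
    · obtain ⟨T, hTS, hT⟩ := Finset.exists_subset_card_eq hS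
      obtain ⟨i, hi⟩ : ∃ i, i ∉ T := by
        by_contra! hall
        have : T = Finset.univ := Finset.eq_univ_iff_forall.2 hall
        rw [this, Finset.card_univ, Fintype.card_fin] at hT
        omega
      rw [Matrix.det_succ_row M i]
      refine Finset.dvd_sum fun j _ => Dvd.dvd.mul_left ?_ _
      refine ih _ (T.preimage i.succAbove Fin.succAbove_right_injective.injOn) ?_ ?_
      · rw [Finset.card_preimage, Finset.filter_true_of_mem, hT]
        intro x hx
        rw [Fin.range_succAbove]
        rintro rfl
        exact hi hx
      · intro f g hf
        refine h (f.trans i.succAboveOrderEmb) (g.trans j.succAboveOrderEmb) fun l => hTS ?_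
        simpa using hf l
    · have hm : S.card ≤ m + 1 := by simpa using S.card_le_univ
      obtain rfl : k = m + 1 := by omega
      have hS' : S = Finset.univ := (Finset.card_eq_iff_eq_univ S).1 (by simp; omega)
      simpa using h (RelEmbedding.refl _) (RelEmbedding.refl _) (by simp [hS'])

/-- If `d` divides all minors of `A` of order `n - r` and all minors of `P` of order `r + 1`
vanish, then `d` divides `det (A + P)`. -/
theorem dvd_det_add {d : R} {n r : ℕ} (A P : Matrix (Fin n) (Fin n) R)
    (hA : ∀ f g : Fin (n - r) ↪o Fin n, d ∣ (A.submatrix f g).det)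
    (hP : ∀ f g : Fin (r + 1) ↪o Fin n, (P.submatrix f g).det = 0) : d ∣ (A + P).det := by
  classical
  have hexp : (A + P).det = ∑ S : Finset (Fin n), Matrix.det (S.piecewise A P) :=
    (Matrix.detRowAlternating (n := Fin n) (R := R)).toMultilinearMap.map_add_univ A P
  rw [hexp]
  refine Finset.dvd_sum fun S _ => ?_
  rcases Nat.lt_or_ge S.card (n - r) with hS | hS
  -- The vanishing of this term is the same Laplace argument with divisor `0`, applied to the rows
  -- taken from `P`.
  · suffices (0 : R) ∣ Matrix.det (S.piecewise A P) from (zero_dvd_iff.1 this) ▸ dvd_zero d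
    refine dvd_det_of_forall_dvd_minor (k := r + 1) _ Sᶜ ?_ fun f g hf => ?_
    · rw [Finset.card_compl, Fintype.card_fin]
      omega
    · rw [zero_dvd_iff, ← hP f g]
      congr 1
      ext i j
      have hi := Finset.mem_compl.1 (hf i)
      exact congrFun (Finset.piecewise_eq_of_notMem S A P hi) (g j)
  · refine dvd_det_of_forall_dvd_minor _ S hS fun f g hf => ?_
    convert hA f g using 2
    ext i j
    exact congrFun (Finset.piecewise_eq_of_mem S A P (hf i)) (g j)

end CommRing

/-! ### Determinantal divisors and root multiplicities -/

section Field

variable {F : Type*} [Field F] {m n : ℕ}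

theorem det_submatrix_eq_zero_of_normalRank_lt {k : ℕ} (G : Matrix (Fin m) (Fin n) F[X])
    (h : normalRank G < k) (f : Fin k → Fin m) (g : Fin k → Fin n) :
    (G.submatrix f g).det = 0 := by
  by_contra hdet
  set H := G.map (algebraMap F[X] (RatFunc F)) with hH
  have hne : (H.submatrix f g).det ≠ 0 := by
    have : (H.submatrix f g).det = algebraMap F[X] (RatFunc F) (G.submatrix f g).det := by
      rw [RingHom.map_det]
      rfl
    rw [this]
    exact (map_ne_zero_iff _ (IsFractionRing.injective F[X] (RatFunc F))).2 hdet
  have hrank : (H.submatrix f g).rank = k := by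
    rw [Matrix.rank_of_isUnit _ ((Matrix.isUnit_iff_isUnit_det _).2 hne.isUnit), Fintype.card_fin]
  have hle : (H.submatrix f g).rank ≤ H.rank := H.rank_submatrix_le f g
  have : H.rank = normalRank G := rfl
  omega

theorem determinantalDivisor_dvd_succ (G : Matrix (Fin m) (Fin n) F[X]) (k : ℕ) :
    determinantalDivisor G k ∣ determinantalDivisor G (k + 1) := by
  rw [dvd_determinantalDivisor_iff]
  intro f g
  rw [Matrix.det_succ_row _ 0]
  refine Finset.dvd_sum fun j _ => Dvd.dvd.mul_left ?_ _
  exact (dvd_determinantalDivisor_iff G k _).1 dvd_rfl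
    ((Fin.succAboveOrderEmb 0).trans f) (j.succAboveOrderEmb.trans g)

theorem determinantalDivisor_dvd_of_le (G : Matrix (Fin m) (Fin n) F[X]) {k l : ℕ} (h : k ≤ l) :
    determinantalDivisor G k ∣ determinantalDivisor G l := by
  induction l, h using Nat.le_induction with
  | base => exact dvd_rfl
  | succ l _ ih => exact ih.trans (determinantalDivisor_dvd_succ G l)

theorem isUnit_determinantalDivisor_zero (G : Matrix (Fin m) (Fin n) F[X]) :
    IsUnit (determinantalDivisor G 0) := by
  have := (dvd_determinantalDivisor_iff G 0 _).1 dvd_rfl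
    (OrderEmbedding.ofStrictMono Fin.elim0 fun i => i.elim0)
    (OrderEmbedding.ofStrictMono Fin.elim0 fun i => i.elim0)
  simpa [isUnit_iff_dvd_one] using this

theorem dvd_determinantalDivisor_self_iff (G : Matrix (Fin n) (Fin n) F[X]) (d : F[X]) :
    d ∣ determinantalDivisor G n ↔ d ∣ G.det := by
  rw [dvd_determinantalDivisor_iff]
  refine ⟨fun h => by simpa using h (RelEmbedding.refl _) (RelEmbedding.refl _), fun h f g => ?_⟩
  -- A strictly monotone self-map of `Fin n` is the identity, so the determinant is the only minor
  -- of order `n`.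
  have key : ∀ f : Fin n ↪o Fin n, (f : Fin n → Fin n) = id := fun f =>
    (f.strictMono.range_inj strictMono_id).1
      (by rw [Set.range_id, (Finite.surjective_of_injective f.injective).range_eq])
  simpa [key f, key g] using h

theorem determinantalDivisor_ne_zero {G : Matrix (Fin n) (Fin n) F[X]} (hG : G.det ≠ 0) {k : ℕ}
    (hk : k ≤ n) : determinantalDivisor G k ≠ 0 := by
  intro h
  have h1 : (0 : F[X]) ∣ determinantalDivisor G n := h ▸ determinantalDivisor_dvd_of_le G hk
  exact hG (zero_dvd_iff.1 ((dvd_determinantalDivisor_self_iff G 0).1 h1))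

theorem determinantalDivisor_mul_invariantFactor (G : Matrix (Fin m) (Fin n) F[X]) {k : ℕ}
    (hG : determinantalDivisor G k ≠ 0) :
    determinantalDivisor G k * invariantFactor G (k + 1) = determinantalDivisor G (k + 1) :=
  EuclideanDomain.mul_div_cancel' hG (determinantalDivisor_dvd_succ G k)

/-- The multiplicities of a root in the first `k` invariant factors add up to its multiplicity in
the determinantal divisor of order `k`. -/
theorem sum_rootMultiplicity_invariantFactor {K : Type*} [Field K] (φ : F →+* K) (a : K)
    {G : Matrix (Fin n) (Fin n) F[X]} (hG : G.det ≠ 0) {k : ℕ} (hk : k ≤ n) :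
    ∑ i ∈ Finset.Icc 1 k, ((invariantFactor G i).map φ).rootMultiplicity a =
      ((determinantalDivisor G k).map φ).rootMultiplicity a := by
  induction k with
  | zero =>
    obtain ⟨c, hc, h⟩ := Polynomial.isUnit_iff.1 (isUnit_determinantalDivisor_zero G)
    simp [← h]
  | succ k ih =>
    have h0 := determinantalDivisor_ne_zero hG hk
    rw [Finset.sum_Icc_succ_top (by omega), ih (by omega),
      ← determinantalDivisor_mul_invariantFactor G (determinantalDivisor_ne_zero hG (by omega)),
      Polynomial.map_mul, Polynomial.rootMultiplicity_mul]
    rw [← Polynomial.map_mul,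
      determinantalDivisor_mul_invariantFactor G (determinantalDivisor_ne_zero hG (by omega))]
    exact (Polynomial.map_ne_zero_iff φ.injective).2 h0

/-- A general `φ` covers both cases: the embedding into the algebraic closure for finite points, the
identity with `a = 0` for reversals. The rank of `P` enters through its minors because their
vanishing passes directly to the reversal. -/
theorem sum_rootMultiplicity_le {K : Type*} [Field K] (φ : F →+* K) (a : K) {r : ℕ}
    {A P : Matrix (Fin n) (Fin n) F[X]} (hA : A.det ≠ 0) (hAP : (A + P).det ≠ 0)
    (hP : ∀ f g : Fin (r + 1) ↪o Fin n, (P.submatrix f g).det = 0) :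
    ∑ i ∈ Finset.Icc 1 n, ((invariantFactor A i).map φ).rootMultiplicity a ≤
      ∑ i ∈ Finset.Icc (n - r + 1) n, ((invariantFactor A i).map φ).rootMultiplicity a +
      ∑ i ∈ Finset.Icc 1 n, ((invariantFactor (A + P) i).map φ).rootMultiplicity a := by
  have hdvd : determinantalDivisor A (n - r) ∣ determinantalDivisor (A + P) n :=
    (dvd_determinantalDivisor_self_iff _ _).2
      (dvd_det_add A P ((dvd_determinantalDivisor_iff A (n - r) _).1 dvd_rfl) hP)
  have hle : ((determinantalDivisor A (n - r)).map φ).rootMultiplicity a ≤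
      ((determinantalDivisor (A + P) n).map φ).rootMultiplicity a :=
    Polynomial.rootMultiplicity_le_rootMultiplicity_of_dvd
      ((Polynomial.map_ne_zero_iff φ.injective).2 (determinantalDivisor_ne_zero hAP le_rfl))
      (Polynomial.map_dvd φ hdvd) a
  have hunion : Finset.Icc 1 n = Finset.Icc 1 (n - r) ∪ Finset.Icc (n - r + 1) n := by
    ext i
    simp only [Finset.mem_Icc, Finset.mem_union]
    omega
  have hdisj : Disjoint (Finset.Icc 1 (n - r)) (Finset.Icc (n - r + 1) n) := by
    rw [Finset.disjoint_left]
    intro i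
    simp only [Finset.mem_Icc]
    omega
  have hsplit := Finset.sum_union hdisj (f := fun i =>
    ((invariantFactor A i).map φ).rootMultiplicity a)
  rw [← hunion, sum_rootMultiplicity_invariantFactor φ a hA (Nat.sub_le n r)] at hsplit
  have hAPsum := sum_rootMultiplicity_invariantFactor φ a hAP le_rfl
  omega

/-! ### Reversal of pencils -/

theorem reversal_add (A B : Matrix (Fin m) (Fin n) F[X]) :
    reversal (A + B) = reversal A + reversal B := by
  ext1 i j
  simp only [reversal, Matrix.map_apply, Matrix.add_apply, coeff_add, C_add]
  ring

theorem reversal_reversal {G : Matrix (Fin m) (Fin n) F[X]} (hG : IsPencil G) :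
    reversal (reversal G) = G := by
  ext1 i j
  have hp := eq_X_add_C_of_degree_le_one (hG i j)
  simp only [reversal, Matrix.map_apply, X_mul_C]
  simpa using hp.symm

theorem isPencil_reversal (G : Matrix (Fin m) (Fin n) F[X]) : IsPencil (reversal G) := by
  intro i j
  simp only [reversal, Matrix.map_apply, X_mul_C]
  exact degree_linear_le

theorem IsPencil.submatrix {G : Matrix (Fin m) (Fin n) F[X]} (hG : IsPencil G) {k l : ℕ}
    (f : Fin k → Fin m) (g : Fin l → Fin n) : IsPencil (G.submatrix f g) :=
  fun i j => hG (f i) (g j)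

/-- The determinant of the reversal `t ^ n * G (1 / t)` vanishes if that of the pencil `G` does. -/
theorem det_reversal_eq_zero {G : Matrix (Fin n) (Fin n) F[X]} (hG : IsPencil G)
    (h : G.det = 0) : (reversal G).det = 0 := by
  -- The substitution of `1 / t` for the variable, with values in the rational functions.
  set ψ : F[X] →+* RatFunc F := eval₂RingHom RatFunc.C RatFunc.X⁻¹
  have hent : (reversal G).map (algebraMap F[X] (RatFunc F)) =
      (RatFunc.X : RatFunc F) • G.map ψ := by
    ext1 i j
    have hp : ψ (G i j) = RatFunc.C ((G i j).coeff 1) * RatFunc.X⁻¹ +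
        RatFunc.C ((G i j).coeff 0) := by
      conv_lhs => rw [eq_X_add_C_of_degree_le_one (hG i j)]
      simp only [ψ, coe_eval₂RingHom, eval₂_add, eval₂_mul, eval₂_C, eval₂_X]
    have hX := RatFunc.X_ne_zero (K := F)
    simp only [reversal, Matrix.map_apply, Matrix.smul_apply, smul_eq_mul, map_add, map_mul, hp,
      RatFunc.algebraMap_X, RatFunc.algebraMap_C]
    field_simp
    ring
  have hdet : algebraMap F[X] (RatFunc F) (reversal G).det = 0 := by
    have h1 : (G.map ψ).det = ψ G.det := (RingHom.map_det ψ G).symm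
    rw [RingHom.map_det, RingHom.mapMatrix_apply, hent, Matrix.det_smul, h1, h, map_zero, mul_zero]
  exact (map_eq_zero_iff _ (IsFractionRing.injective F[X] (RatFunc F))).1 hdet

theorem det_reversal_ne_zero {G : Matrix (Fin n) (Fin n) F[X]} (hG : IsRegular G) :
    (reversal G).det ≠ 0 := fun h => hG.2 <| by
  rw [← reversal_reversal hG.1]
  exact det_reversal_eq_zero (isPencil_reversal G) h

end Field

end MatrixPencil

theorem corollary5p2 {F : Type*} [Field F] {n r : ℕ} (A P : Matrix (Fin n) (Fin n) (Polynomial F))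
    (hP : MatrixPencil.IsPencil P) (hr : MatrixPencil.normalRank P = r)
    (hA : MatrixPencil.IsRegular A) (hAP : MatrixPencil.IsRegular (A + P))
    (z : OnePoint (AlgebraicClosure F)) :
    (MatrixPencil.algebraicMultiplicity z A : ℤ) - (MatrixPencil.largestMultiplicitySum r z A : ℤ) ≤
      (MatrixPencil.algebraicMultiplicity z (A + P) : ℤ) := by
  have hminor : ∀ f g : Fin (r + 1) ↪o Fin n, (P.submatrix f g).det = 0 := fun f g =>
    MatrixPencil.det_submatrix_eq_zero_of_normalRank_lt P (by omega) f g
  rw [sub_le_iff_le_add']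
  norm_cast
  cases z using OnePoint.rec with
  | infty =>
    have hrev := MatrixPencil.sum_rootMultiplicity_le (RingHom.id F) 0 (r := r)
      (A := MatrixPencil.reversal A) (P := MatrixPencil.reversal P)
      (MatrixPencil.det_reversal_ne_zero hA)
      (MatrixPencil.reversal_add A P ▸ MatrixPencil.det_reversal_ne_zero hAP)
      -- Reversal acts entrywise, so it commutes definitionally with taking submatrices.
      (fun f g => MatrixPencil.det_reversal_eq_zero (hP.submatrix f g) (hminor f g))
    simp only [Polynomial.map_id, ← MatrixPencil.reversal_add] at hrev
    exact hrev
  | coe a =>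
    exact MatrixPencil.sum_rootMultiplicity_le (algebraMap F (AlgebraicClosure F)) a
      hA.2 hAP.2 hminor
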